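/- Let $H$ be a complex Hilbert space and let $\{L_n\}_{n\in\mathbb Z}$ be the generators of a unitary positive-energy representation of the Virasoro algebra on $H$ with central charge $c\in\mathbb R$. This means: the $L_n$ are (possibly unbounded) operators on $H$; the space $\mathcal D_{fin}$ of finite-energy vectors, i.e. the linear span of the eigenvectors of $L_0$, is dense in $H$, is contained in the domain of every $L_n$ and is left invariant by every $L_n$; and on $\mathcal D_{fin}$ one has $\langle L_n v,w\rangle=\langle v,L_{-n}w\rangle$, $[L_n,L_m]=(n-m)L_{n+m}+\frac{c}{12}(n^3-n)\delta_{m,-n}\mathbb 1$ for all $n,m\in\mathbb Z$, and $\langle v,L_0v\rangle\ge 0$. (For instance, the $L_n$ can be the infinitesimal generators of a positive-energy strongly continuous projective unitary representation of $\mathrm{Diff}^+(S^1)$.) Let $a_n\in\mathbb C$ $(n\in\mathbb Z)$ be such that $\sum_{n\in\mathbb Z}|a_n||n|^{3/2}<\infty$. Then the series $Av=\sum_{n\in\mathbb Z}a_nL_nv$ and $A^+v=\sum_{n\in\mathbb Z}\overline{a_{-n}}L_nv$ converge for every $v\in\mathcal D_{fin}$, and the operators $A$ and $A^+$ with domain $\mathcal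 D_{fin}$ satisfy: $A$ is closable and $\overline A=(A^+)^*$. In particular, if $a_n=\overline{a_{-n}}$ for all $n\in\mathbb Z$, then $A$ is essentially self-adjoint on $\mathcal D_{fin}$. Consequently, if $f:S^1\to\mathbb R$ is a continuous function with Fourier coefficients $\hat f_n=\frac1{2\pi}\int_0^{2\pi}e^{-in\alpha}f(e^{i\alpha})\,d\alpha$ such that $\|f\|_{3/2}=\sum_{n\in\mathbb Z}|\hat f_n|(1+|n|^{3/2})<\infty$, then $\sum_{n\in\mathbb Z}\hat f_nL_n$ is well defined and essentially self-adjoint on $\mathcal D_{fin}$, so that its closure $T(f)$ is a self-adjoint operator. -/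

import Mathlib

open scoped InnerProductSpace ComplexConjugate

noncomputable section

namespace Virasoro

variable {H : Type*} [NormedAddCommGroup H] [InnerProductSpace ℂ H]

/-- The linear span of all eigenvectors of the (partially defined) operator `T`.
For `T = L₀` this is the space of finite-energy vectors. -/
def eigenSpan (T : H →ₗ.[ℂ] H) : Submodule ℂ H :=
  Submodule.span ℂ {v : H | ∃ (k : ℂ) (hv : v ∈ T.domain), T ⟨v, hv⟩ = k • v}

variable (H) in
/-- The generators `L n` (`n ∈ ℤ`) of a unitary positive-energy representation of the Virasoro
algebra on `H`. They are possibly unbounded operators, whose domains contain the space of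
finite-energy vectors `eigenSpan (L 0)`; the domains may be larger, e.g. the `L n` may be closed.
All the laws are required on finite-energy vectors only. In particular, neither closedness of the
`L n`, nor the finite-energy vectors being a core for them, nor equality of the operators
`(L n)†` and `L (-n)` is required. -/
structure PositiveEnergyRep where
  /-- the generators -/
  L : ℤ → H →ₗ.[ℂ] H
  /-- the central charge -/
  c : ℝ
  /-- the finite-energy vectors are dense -/
  dense_fin : Dense (eigenSpan (L 0) : Set H)
  /-- the generators are defined on finite-energy vectors -/
  fin_le_domain : ∀ n : ℤ, eigenSpan (L 0) ≤ (L n).domain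
  /-- the generators leave the space of finite-energy vectors invariant -/
  fin_invariant : ∀ (n : ℤ) (v : H) (hv : v ∈ eigenSpan (L 0)),
    L n ⟨v, fin_le_domain n hv⟩ ∈ eigenSpan (L 0)
  /-- unitarity: `L (-n)` is a formal adjoint of `L n` -/
  unitarity : ∀ (n : ℤ) (v w : H) (hv : v ∈ eigenSpan (L 0)) (hw : w ∈ eigenSpan (L 0)),
    ⟪L n ⟨v, fin_le_domain n hv⟩, w⟫_ℂ = ⟪v, L (-n) ⟨w, fin_le_domain (-n) hw⟩⟫_ℂ
  /-- the Virasoro algebra relations -/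
  virasoro : ∀ (n m : ℤ) (v : H) (hv : v ∈ eigenSpan (L 0)),
    L n ⟨L m ⟨v, fin_le_domain m hv⟩, fin_le_domain n (fin_invariant m v hv)⟩
      - L m ⟨L n ⟨v, fin_le_domain n hv⟩, fin_le_domain m (fin_invariant n v hv)⟩
    = ((n : ℂ) - (m : ℂ)) • L (n + m) ⟨v, fin_le_domain (n + m) hv⟩
      + (if m = -n then ((c : ℂ) / 12) * ((n : ℂ) ^ 3 - (n : ℂ)) else 0) • v
  /-- positivity of the energy `L 0` -/
  positive_energy : ∀ (v : H) (hv : v ∈ eigenSpan (L 0)),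
    0 ≤ (⟪v, L 0 ⟨v, fin_le_domain 0 hv⟩⟫_ℂ).re

namespace PositiveEnergyRep

variable (R : PositiveEnergyRep H)

/-- The space of finite-energy vectors: the span of the eigenvectors of `L 0`. -/
def Dfin : Submodule ℂ H := eigenSpan (R.L 0)

/-- The value of the `n`-th generator on a finite-energy vector, linear in the vector. -/
def gen (n : ℤ) : R.Dfin →ₗ[ℂ] H :=
  (R.L n).toFun ∘ₗ Submodule.inclusion (R.fin_le_domain n)

/-- The operator `∑ₙ aₙ Lₙ` on those finite-energy vectors on which the series converges in `H`.
(Convergence on every finite-energy vector, i.e. `(R.series a).domain = R.Dfin`, is not built in: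
it has to be proved for the coefficients at hand.) -/
def series (a : ℤ → ℂ) : H →ₗ.[ℂ] H where
  domain :=
    { carrier := {v | ∃ hv : v ∈ R.Dfin, Summable fun n : ℤ => a n • R.gen n ⟨v, hv⟩}
      zero_mem' := by
        refine ⟨zero_mem _, ?_⟩
        have h : ∀ n : ℤ, R.gen n ⟨0, zero_mem _⟩ = 0 := fun n => map_zero (R.gen n)
        simp only [h, smul_zero]
        exact summable_zero
      add_mem' := by
        rintro v w ⟨hv, hv'⟩ ⟨hw, hw'⟩
        refine ⟨add_mem hv hw, ?_⟩
        have h : ∀ n : ℤ, R.gen n ⟨v + w, add_mem hv hw⟩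
            = R.gen n ⟨v, hv⟩ + R.gen n ⟨w, hw⟩ := fun n => map_add (R.gen n) ⟨v, hv⟩ ⟨w, hw⟩
        simp only [h, smul_add]
        exact hv'.add hw'
      smul_mem' := by
        rintro z v ⟨hv, hv'⟩
        refine ⟨Submodule.smul_mem _ z hv, ?_⟩
        have h : ∀ n : ℤ, R.gen n ⟨z • v, Submodule.smul_mem _ z hv⟩
            = z • R.gen n ⟨v, hv⟩ := fun n => map_smul (R.gen n) z ⟨v, hv⟩
        simp only [h, smul_comm _ z]
        exact hv'.const_smul z }
  toFun :=
    { toFun := fun v => ∑' n : ℤ, a n • R.gen n ⟨v, v.2.fst⟩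
      map_add' := by
        rintro ⟨v, hv, hv'⟩ ⟨w, hw, hw'⟩
        have h : ∀ n : ℤ, R.gen n ⟨v + w, add_mem hv hw⟩
            = R.gen n ⟨v, hv⟩ + R.gen n ⟨w, hw⟩ := fun n => map_add (R.gen n) ⟨v, hv⟩ ⟨w, hw⟩
        refine (tsum_congr fun n => ?_).trans (hv'.tsum_add hw')
        rw [← smul_add, ← h n]
        rfl
      map_smul' := by
        rintro z ⟨v, hv, hv'⟩
        have h : ∀ n : ℤ, R.gen n ⟨z • v, Submodule.smul_mem _ z hv⟩
            = z • R.gen n ⟨v, hv⟩ := fun n => map_smul (R.gen n) z ⟨v, hv⟩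
        refine (tsum_congr fun n => ?_).trans (hv'.tsum_const_smul z)
        rw [smul_comm z, ← h n]
        rfl }

end PositiveEnergyRep

/-- The coefficients of `A⁺ = ∑ₙ conj(a₋ₙ) Lₙ`, where `A = ∑ₙ aₙ Lₙ`. -/
def plusCoeff (a : ℤ → ℂ) (n : ℤ) : ℂ := conj (a (-n))

/-- The Fourier coefficients `(2π)⁻¹ ∫₀^{2π} e^{-inα} f(e^{iα}) dα` of a real function on the
circle. -/
def fourierHat (f : Circle → ℝ) (n : ℤ) : ℂ :=
  (1 / (2 * (Real.pi : ℂ))) *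
    ∫ α in (0 : ℝ)..(2 * Real.pi),
      Complex.exp (-(Complex.I * (n : ℂ) * (α : ℂ))) * ((f (Circle.exp α) : ℝ) : ℂ)

/-- An operator is essentially self-adjoint if it is densely defined, closable, and its closure is
self-adjoint. -/
def EssentiallySelfAdjoint [CompleteSpace H] (A : H →ₗ.[ℂ] H) : Prop :=
  Dense (A.domain : Set H) ∧ A.IsClosable ∧ IsSelfAdjoint A.closure

/-- The operator `T(f)`: the closure of `∑ₙ f̂ₙ Lₙ` on the finite-energy vectors. -/
def PositiveEnergyRep.stressEnergy (R : PositiveEnergyRep H) (f : Circle → ℝ) : H →ₗ.[ℂ] H :=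
  (R.series (fourierHat f)).closure

end Virasoro

end

/-! Write `φₖ(L₀)` for the cutoff `reg k`. Two estimates, both uniform on finite-energy vectors and
both growing in `n` like `1 + |n|^{3/2}`, carry the proof. The energy bound `norm_act_le` controls
`Lₙ` by `1 + L₀`, so the series converge. The commutator bound `norm_regComm_le` controls `[φₖ(L₀),
Lₙ]` by a constant independent of `k`.

The inclusion of `closure A` in `(A⁺)*` is formal. For the converse, take `x` in the domain of
`(A⁺)*` and finite-energy vectors `vₖ → x`, chosen fast enough to beat the norm of `A⁺ φₖ(L₀)`,
which is `O(k)`. With `uₖ = φₖ(L₀) vₖ`, the commutator bound keeps `A uₖ` bounded, and then `uₖ → x`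
and `A uₖ → (A⁺)* x` weakly (`exists_tendsto_inner`). Pairing with `q` in the domain of `A*` gives
`⟪(A⁺)* x, q⟫ = ⟪x, A* q⟫`, so the graph of `(A⁺)*` lies in the double adjoint of the graph of `A`,
hence in its closure. -/

open scoped InnerProductSpace ComplexConjugate
open Filter Topology Module.End

/-! ### Hilbert space preliminaries: double adjoints and weak convergence. -/

namespace Submodule

variable {E F : Type*} [NormedAddCommGroup E] [InnerProductSpace ℂ E] [CompleteSpace E]
  [NormedAddCommGroup F] [InnerProductSpace ℂ F] [CompleteSpace F]

/-- The double adjoint of a linear relation lies in its closure. -/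
theorem adjoint_adjoint_le_topologicalClosure (g : Submodule ℂ (E × F)) :
    g.adjoint.adjoint ≤ g.topologicalClosure := by
  intro x hx
  rw [mem_adjoint_iff] at hx
  -- In the Hilbert sum the adjoint relation is the orthogonal complement turned by `(s, t) ↦ (t,
  -- -s)`, so the claim reduces to `Kᗮᗮ = closure K`.
  let e := WithLp.prodContinuousLinearEquiv 2 ℂ E F
  let K : Submodule ℂ (WithLp 2 (E × F)) := g.comap e.toLinearEquiv.toLinearMap
  have hK : e.symm x ∈ K.topologicalClosure := by
    rw [← orthogonal_orthogonal_eq_closure, mem_orthogonal]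
    intro u hu
    rw [mem_orthogonal] at hu
    have h1 : ((e u).2, -(e u).1) ∈ g.adjoint := by
      rw [mem_adjoint_iff]
      intro a b hab
      have := hu (e.symm (a, b)) (by simpa [K] using hab)
      simp only [WithLp.prod_inner_apply] at this
      simp only [inner_neg_right]
      rw [sub_neg_eq_add, add_comm]
      exact this
    have h2 := hx _ _ h1
    simp only [inner_neg_left] at h2
    rw [WithLp.prod_inner_apply]
    have h3 : -(inner ℂ (e u).1 x.1 + inner ℂ (e u).2 x.2) = 0 := by rw [← h2]; ring
    exact neg_eq_zero.mp h3
  rw [← SetLike.mem_coe, topologicalClosure_coe] at hK ⊢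
  simpa using map_mem_closure e.continuous hK (t := (g : Set (E × F))) (fun z hz => hz)

end Submodule

/-- A bounded sequence converges weakly as soon as it does so against a dense subset. -/
theorem tendsto_inner_of_dense {H : Type*} [NormedAddCommGroup H] [InnerProductSpace ℂ H]
    {D : Set H} (hD : Dense D) {u : ℕ → H} {x : H} {C : ℝ} (hu : ∀ k, ‖u k‖ ≤ C)
    (h : ∀ w ∈ D, Tendsto (fun k => ⟪u k, w⟫_ℂ) atTop (𝓝 ⟪x, w⟫_ℂ)) (q : H) :
    Tendsto (fun k => ⟪u k, q⟫_ℂ) atTop (𝓝 ⟪x, q⟫_ℂ) := by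
  have hC : 0 ≤ C := (norm_nonneg _).trans (hu 0)
  rw [Metric.tendsto_atTop]
  intro ε hε
  set δ := ε / (2 * (C + ‖x‖ + 1)) with hδ
  have hM : 0 < C + ‖x‖ + 1 := by positivity
  have hδ0 : 0 < δ := by positivity
  obtain ⟨w, hwq, hwD⟩ := Metric.dense_iff.mp hD q δ hδ0
  obtain ⟨N, hN⟩ := Metric.tendsto_atTop.mp (h w hwD) (ε / 2) (by positivity)
  refine ⟨N, fun k hk => ?_⟩
  have h1 := hN k hk
  rw [dist_eq_norm, ← inner_sub_left] at h1 ⊢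
  have h2 : ⟪u k - x, q⟫_ℂ = ⟪u k - x, w⟫_ℂ + ⟪u k - x, q - w⟫_ℂ := by
    rw [← inner_add_right, add_sub_cancel]
  have h3 : ‖⟪u k - x, q - w⟫_ℂ‖ ≤ (C + ‖x‖ + 1) * δ := by
    refine (norm_inner_le_norm _ _).trans ?_
    gcongr
    · linarith [norm_sub_le (u k) x, hu k]
    · rw [← dist_eq_norm, dist_comm]; exact (Metric.mem_ball.mp hwq).le
  have h4 : (C + ‖x‖ + 1) * δ = ε / 2 := by rw [hδ]; field_simp
  rw [h2]
  linarith [norm_add_le ⟪u k - x, w⟫_ℂ ⟪u k - x, q - w⟫_ℂ]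

/-! ### Operators on an algebraic sum of eigenspaces. -/

namespace LinearMap.IsSymmetric

variable {E : Type*} [NormedAddCommGroup E] [InnerProductSpace ℂ E] {S : E →ₗ[ℂ] E}

/-- Eigenspaces of a symmetric operator are orthogonal, and `X` shifts all of them by the same `d`,
so Pythagoras applies to both sides. Uniform bounds therefore need checking on eigenvectors only. -/
theorem norm_le_of_eigenspace (hS : S.IsSymmetric) (htop : ⨆ μ, eigenspace S μ = ⊤)
    {X Y : E →ₗ[ℂ] E} (d : ℂ) (hX : ∀ μ, ∀ v ∈ eigenspace S μ, X v ∈ eigenspace S (μ + d))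
    (hY : ∀ μ, ∀ v ∈ eigenspace S μ, Y v ∈ eigenspace S μ)
    (h : ∀ μ, ∀ v ∈ eigenspace S μ, ‖X v‖ ≤ ‖Y v‖) (v : E) : ‖X v‖ ≤ ‖Y v‖ := by
  classical
  have hv : v ∈ ⨆ μ, eigenspace S μ := htop ▸ Submodule.mem_top
  obtain ⟨f, rfl⟩ := (Submodule.mem_iSup_iff_exists_dfinsupp' _ _).mp hv
  have hV := hS.orthogonalFamily_eigenspaces
  have hV' := hV.comp (γ := ℂ) (f := fun μ => μ + d) (add_left_injective d)
  have e1 := hV'.norm_sum (fun μ => ⟨X (f μ), hX μ _ (f μ).2⟩) f.support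
  have e2 := hV.norm_sum (fun μ => ⟨Y (f μ), hY μ _ (f μ).2⟩) f.support
  have hle : ‖X (f.sum fun _ xi => (xi : E))‖ ^ 2 ≤ ‖Y (f.sum fun _ xi => (xi : E))‖ ^ 2 := by
    rw [DFinsupp.sum, map_sum, map_sum]
    refine e1.trans_le (le_trans ?_ e2.ge)
    exact Finset.sum_le_sum fun μ _ => pow_le_pow_left₀ (norm_nonneg _) (h μ _ (f μ).2) 2
  exact (sq_le_sq₀ (norm_nonneg _) (norm_nonneg _)).mp hle

/-- A purely algebraic functional calculus `φ(S)`: the space is the direct sum of the eigenspaces,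
so scalars may be prescribed on each of them. -/
theorem exists_eigenspace_multiplier (htop : ⨆ μ, eigenspace S μ = ⊤) (φ : ℂ → ℂ) :
    ∃ T : E →ₗ[ℂ] E, ∀ μ, ∀ v ∈ eigenspace S μ, T v = φ μ • v := by
  classical
  have hint : DirectSum.IsInternal (eigenspace S) :=
    DirectSum.isInternal_submodule_of_iSupIndep_of_iSup_eq_top (eigenspaces_iSupIndep S) htop
  let e := LinearEquiv.ofBijective (DirectSum.coeLinearMap (eigenspace S)) hint
  refine ⟨(DirectSum.toModule ℂ ℂ E fun μ => φ μ • (eigenspace S μ).subtype) ∘ₗ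
    e.symm.toLinearMap, fun μ v hv => ?_⟩
  have : e.symm v = DirectSum.lof ℂ ℂ (fun μ => eigenspace S μ) μ ⟨v, hv⟩ := by
    rw [LinearEquiv.symm_apply_eq]
    exact (DirectSum.coeLinearMap_lof (eigenspace S) μ ⟨v, hv⟩).symm
  simp [this]

end LinearMap.IsSymmetric

/-! ### The Virasoro generators on vectors of fixed energy. -/

namespace Virasoro.PositiveEnergyRep

variable {H : Type*} [NormedAddCommGroup H] [InnerProductSpace ℂ H] (R : PositiveEnergyRep H)

/-- The `n`-th generator as an endomorphism of the space of finite-energy vectors. -/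
noncomputable def act (n : ℤ) : R.Dfin →ₗ[ℂ] R.Dfin :=
  (R.gen n).codRestrict R.Dfin fun v => R.fin_invariant n v v.2

theorem inner_act_left (n : ℤ) (v w : R.Dfin) : ⟪R.act n v, w⟫_ℂ = ⟪v, R.act (-n) w⟫_ℂ :=
  R.unitarity n v w v.2 w.2

theorem inner_act_right (n : ℤ) (v w : R.Dfin) : ⟪v, R.act n w⟫_ℂ = ⟪R.act (-n) v, w⟫_ℂ := by
  rw [inner_act_left, neg_neg]

theorem act_commutator (n m : ℤ) (v : R.Dfin) :
    R.act n (R.act m v) - R.act m (R.act n v) = ((n : ℂ) - (m : ℂ)) • R.act (n + m) v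
      + (if m = -n then ((R.c : ℂ) / 12) * ((n : ℂ) ^ 3 - (n : ℂ)) else 0) • v :=
  Subtype.ext (R.virasoro n m v v.2)

theorem isSymmetric_act_zero : (R.act 0).IsSymmetric := fun v w => by
  simpa using R.inner_act_left 0 v w

theorem iSup_eigenspace_act_zero : ⨆ μ, eigenspace (R.act 0) μ = ⊤ := by
  rw [eq_top_iff]
  rintro ⟨v, hv⟩ -
  refine Submodule.span_induction
    (p := fun v hv => (⟨v, hv⟩ : R.Dfin) ∈ ⨆ μ, eigenspace (R.act 0) μ) ?_ ?_ ?_ ?_ hv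
  · rintro v ⟨k, hvd, hk⟩
    refine Submodule.mem_iSup_of_mem k ?_
    rw [mem_eigenspace_iff]
    exact Subtype.ext hk
  · exact zero_mem _
  · intro v w _ _ h1 h2
    exact add_mem h1 h2
  · intro z v _ h
    exact Submodule.smul_mem _ z h

variable {R}

theorem act_mem_eigenspace {μ : ℂ} {v : R.Dfin} (hv : v ∈ eigenspace (R.act 0) μ) (n : ℤ) :
    R.act n v ∈ eigenspace (R.act 0) (μ + -n) := by
  rw [mem_eigenspace_iff] at hv ⊢
  have h := R.act_commutator 0 n v
  have h0 :
      (if n = -0 then ((R.c : ℂ) / 12) * (((0 : ℤ) : ℂ) ^ 3 - ((0 : ℤ) : ℂ)) else 0) = 0 := by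
    simp
  rw [h0, hv, map_smul, zero_smul, add_zero, zero_add, sub_eq_iff_eq_add] at h
  rw [h, ← add_smul]
  push_cast
  congr 1
  ring

theorem exists_energy_of_mem_eigenspace {μ : ℂ} {v : R.Dfin} (hv : v ∈ eigenspace (R.act 0) μ)
    (h0 : v ≠ 0) : ∃ h : ℝ, 0 ≤ h ∧ μ = h := by
  have hμ : conj μ = μ :=
    R.isSymmetric_act_zero.conj_eigenvalue_eq_self (hasEigenvalue_of_hasEigenvector ⟨hv, h0⟩)
  obtain ⟨h, rfl⟩ := Complex.conj_eq_iff_real.mp hμ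
  refine ⟨h, ?_, rfl⟩
  have hp : 0 ≤ (⟪v, R.act 0 v⟫_ℂ).re := R.positive_energy v v.2
  rw [mem_eigenspace_iff.mp hv, inner_smul_right, inner_self_eq_norm_sq_to_K] at hp
  have hp' : 0 ≤ h * ‖v‖ ^ 2 := by
    convert hp using 1
    simp [← Complex.ofReal_pow]
  exact nonneg_of_mul_nonneg_left hp' (by positivity)

theorem eq_zero_of_energy_neg {h : ℝ} {v : R.Dfin} (hv : v ∈ eigenspace (R.act 0) (h : ℂ))
    (h0 : h < 0) : v = 0 := by
  by_contra hne
  obtain ⟨h', h1, h2⟩ := exists_energy_of_mem_eigenspace hv hne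
  rw [Complex.ofReal_inj] at h2
  linarith

theorem act_mem_eigenspace_ofReal {h : ℝ} {v : R.Dfin}
    (hv : v ∈ eigenspace (R.act 0) (h : ℂ)) (n : ℤ) :
    R.act n v ∈ eigenspace (R.act 0) ((h - n : ℝ) : ℂ) := by
  have := act_mem_eigenspace hv n
  rwa [show (h : ℂ) + -n = ((h - n : ℝ) : ℂ) by push_cast; ring] at this

/-- Take the expectation in `w` of `[Lₙ, L₋ₙ] = 2n L₀ + (c/12)(n³ - n)`. -/
theorem norm_act_neg_sq {h : ℝ} {w : R.Dfin} (hw : w ∈ eigenspace (R.act 0) (h : ℂ)) (n : ℤ) :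
    ‖R.act (-n) w‖ ^ 2
      = ‖R.act n w‖ ^ 2 + (2 * n * h + R.c / 12 * ((n : ℝ) ^ 3 - n)) * ‖w‖ ^ 2 := by
  have h1 := R.act_commutator n (-n) w
  rw [if_pos rfl, add_neg_cancel, mem_eigenspace_iff.mp hw, smul_smul, ← add_smul] at h1
  have h2 := congrArg (fun z => ⟪w, z⟫_ℂ) h1
  simp only [inner_sub_right, inner_smul_right] at h2
  rw [R.inner_act_right n w, R.inner_act_right (-n) w, neg_neg, inner_self_eq_norm_sq_to_K,
    inner_self_eq_norm_sq_to_K, inner_self_eq_norm_sq_to_K] at h2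
  have h3 : ((‖R.act (-n) w‖ ^ 2 - ‖R.act n w‖ ^ 2 : ℝ) : ℂ)
      = (((2 * n * h + R.c / 12 * ((n : ℝ) ^ 3 - n)) * ‖w‖ ^ 2 : ℝ) : ℂ) := by
    push_cast
    refine h2.trans ?_
    push_cast
    simp only [Complex.coe_algebraMap]
    ring
  linarith [Complex.ofReal_inj.mp h3]

/-- Cauchy–Schwarz on `‖Lₙ v‖² = ⟪v, L₋ₙ Lₙ v⟫` passes a bound for raising at `Lₙ v` to one for
lowering at `v`. -/
theorem norm_act_sq_le_of_norm_act_neg_sq_le {n : ℤ} {v : R.Dfin} {b : ℝ} (hb0 : 0 ≤ b)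
    (hb : ‖R.act (-n) (R.act n v)‖ ^ 2 ≤ b * ‖R.act n v‖ ^ 2) :
    ‖R.act n v‖ ^ 2 ≤ b * ‖v‖ ^ 2 := by
  rcases eq_or_ne (R.act n v) 0 with h0 | h0
  · rw [h0, norm_zero, zero_pow two_ne_zero]
    positivity
  have h1 : ‖R.act n v‖ ^ 2 ≤ ‖v‖ * ‖R.act (-n) (R.act n v)‖ := by
    have := norm_inner_le_norm (𝕜 := ℂ) v (R.act (-n) (R.act n v))
    rw [← R.inner_act_left, inner_self_eq_norm_sq_to_K] at this
    simpa using this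
  have hp : 0 < ‖R.act n v‖ ^ 2 := by positivity
  have h2 : (‖R.act n v‖ ^ 2) ^ 2 ≤ ‖v‖ ^ 2 * (b * ‖R.act n v‖ ^ 2) := by
    calc _ ≤ (‖v‖ * ‖R.act (-n) (R.act n v)‖) ^ 2 := by gcongr
      _ = ‖v‖ ^ 2 * ‖R.act (-n) (R.act n v)‖ ^ 2 := by ring
      _ ≤ _ := by gcongr
  nlinarith

/-- Bound for the lowering operators on vectors of fixed energy. -/
theorem norm_act_sq_le_of_pos {n : ℤ} (hn : 0 < n) {h : ℝ} {v : R.Dfin}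
    (hv : v ∈ eigenspace (R.act 0) (h : ℂ)) :
    ‖R.act n v‖ ^ 2 ≤ (h ^ 2 + |R.c| * h * n ^ 2 / 12) * ‖v‖ ^ 2 := by
  have hn' : (1 : ℝ) ≤ n := by exact_mod_cast hn
  -- Induction on the energy: `Lₙ` lowers it by `n ≥ 1`, and negative energies carry no nonzero
  -- vector.
  obtain ⟨k, hk⟩ := exists_nat_gt h
  induction k generalizing h v with
  | zero =>
    rw [eq_zero_of_energy_neg hv (by simpa using hk)]
    simp
  | succ k ih =>
    rcases lt_or_ge h 0 with h0 | h0
    · rw [eq_zero_of_energy_neg hv h0]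
      simp
    have hw := act_mem_eigenspace_ofReal hv n
    rcases lt_or_ge (h - n) 0 with h1 | h1
    · rw [eq_zero_of_energy_neg hw h1]
      simp only [norm_zero, ne_eq, OfNat.ofNat_ne_zero, not_false_eq_true, zero_pow]
      positivity
    refine norm_act_sq_le_of_norm_act_neg_sq_le (by positivity) ?_
    rw [norm_act_neg_sq hw]
    have h2 := ih hw (by push_cast at hk; linarith)
    have h3 : R.c / 12 * ((n : ℝ) ^ 3 - n) ≤ |R.c| / 12 * (n : ℝ) ^ 3 := by
      have : 0 ≤ (n : ℝ) ^ 3 - n := by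
        nlinarith [mul_nonneg (sub_nonneg.mpr hn') (sub_nonneg.mpr hn')]
      calc _ ≤ |R.c| / 12 * ((n : ℝ) ^ 3 - n) := by gcongr; exact le_abs_self _
        _ ≤ _ := by gcongr; linarith
    calc _ ≤ (((h - n) ^ 2 + |R.c| * (h - n) * n ^ 2 / 12)
          + (2 * n * (h - n) + |R.c| / 12 * (n : ℝ) ^ 3)) * ‖R.act n v‖ ^ 2 := by
          rw [add_mul _ (2 * n * (h - n) + |R.c| / 12 * (n : ℝ) ^ 3)]
          exact add_le_add h2 (mul_le_mul_of_nonneg_right (by linarith) (sq_nonneg _))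
      _ ≤ _ := by
          refine mul_le_mul_of_nonneg_right ?_ (sq_nonneg _)
          -- The `|c|` terms add up exactly, and `(h - n)² + 2n(h - n) = h² - n²`, so the bound
          -- reproduces itself.
          nlinarith [abs_nonneg R.c]

end Virasoro.PositiveEnergyRep

/-! ### The weight and the energy cutoff. -/

namespace Virasoro

/-- The weight `1 + |n|^{3/2}` governing the size of the generators. -/
noncomputable def weight (n : ℤ) : ℝ := 1 + |(n : ℝ)| ^ (3 / 2 : ℝ)

theorem one_le_weight (n : ℤ) : 1 ≤ weight n := by
  have : 0 ≤ |(n : ℝ)| ^ (3 / 2 : ℝ) := by positivity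
  unfold weight
  linarith

theorem abs_cube_le_weight_sq (n : ℤ) : |(n : ℝ)| ^ 3 ≤ weight n ^ 2 := by
  have h0 : 0 ≤ |(n : ℝ)| ^ (3 / 2 : ℝ) := by positivity
  have h : (|(n : ℝ)| ^ (3 / 2 : ℝ)) ^ 2 = |(n : ℝ)| ^ 3 := by
    rw [← Real.rpow_natCast, ← Real.rpow_mul (abs_nonneg _), ← Real.rpow_natCast]
    norm_num
  rw [← h]
  unfold weight
  gcongr
  linarith

/-- A piecewise linear cutoff function, which tends to `1` as `k → ∞`. -/
noncomputable def cutoff (k : ℕ) (h : ℝ) : ℝ := max 0 (1 - h / (k + 1))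

theorem cutoff_nonneg (k : ℕ) (h : ℝ) : 0 ≤ cutoff k h := le_max_left _ _

theorem cutoff_le_one (k : ℕ) {h : ℝ} (h0 : 0 ≤ h) : cutoff k h ≤ 1 := by
  have : 0 ≤ h / (k + 1) := by positivity
  exact max_le zero_le_one (by linarith)

theorem one_add_mul_cutoff_le (k : ℕ) {h : ℝ} (h0 : 0 ≤ h) :
    (1 + h) * cutoff k h ≤ k + 2 := by
  rcases le_or_gt h (k + 1) with h1 | h1
  · calc _ ≤ (1 + h) * 1 := by gcongr; exact cutoff_le_one k h0
      _ ≤ _ := by linarith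
  · have : cutoff k h = 0 := by
      refine max_eq_left ?_
      rw [sub_nonpos, le_div_iff₀ (by positivity)]
      linarith
    rw [this, mul_zero]
    positivity

theorem tendsto_cutoff (h : ℝ) : Tendsto (fun k => cutoff k h) atTop (𝓝 1) := by
  have h1 : Tendsto (fun k : ℕ => h / ((k : ℝ) + 1)) atTop (𝓝 0) :=
    tendsto_const_nhds.div_atTop (tendsto_atTop_add_const_right _ _ tendsto_natCast_atTop_atTop)
  simpa [cutoff] using (tendsto_const_nhds (x := (0 : ℝ))).max (h1.const_sub 1)

/-- The cutoff has slope at most `1/(k+1)` and vanishes above `k+1`: its increment is at most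
`N/(k+1)`, and zero where the energy exceeds that scale. The factor `k` cancels, leaving a bound
uniform in `k` and `l`. -/
theorem cutoff_diff_sq_mul_le (k : ℕ) {c l N : ℝ} (hc : 0 ≤ c) (hl : 0 ≤ l) (hN : 0 ≤ N) :
    (cutoff k l - cutoff k (l + N)) ^ 2 * ((l + N) ^ 2 + c * (l + N) * N ^ 2 / 12)
      ≤ 4 * N ^ 2 + c * N ^ 3 := by
  set d := cutoff k l - cutoff k (l + N) with hd
  have hk : (0 : ℝ) < k + 1 := by positivity
  have hle : (l + N) / ((k : ℝ) + 1) = l / (k + 1) + N / (k + 1) := add_div _ _ _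
  have hN' : 0 ≤ N / ((k : ℝ) + 1) := by positivity
  have hd0 : 0 ≤ d := sub_nonneg.mpr (max_le_max le_rfl (by rw [hle]; linarith))
  have hd1 : d ≤ 1 := by linarith [cutoff_le_one k hl, cutoff_nonneg k (l + N)]
  have hd2 : d * (k + 1) ≤ N := by
    rw [← le_div_iff₀ hk, hd, sub_le_iff_le_add]
    refine max_le (by linarith [cutoff_nonneg k (l + N)]) ?_
    have : 1 - (l + N) / (k + 1) ≤ cutoff k (l + N) := le_max_right _ _
    rw [hle] at this
    linarith
  have hd3 : d * (l + N) ≤ 2 * N := by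
    rcases le_or_gt l (k + 1) with h | h
    · nlinarith
    · have h1 : cutoff k l = 0 := by
        refine max_eq_left ?_
        rw [sub_nonpos, le_div_iff₀ hk]
        linarith
      have : d = 0 := le_antisymm (by linarith [cutoff_nonneg k (l + N)]) hd0
      rw [this]
      linarith
  have e1 : (d * (l + N)) ^ 2 ≤ (2 * N) ^ 2 := by gcongr
  have e2 : d ^ 2 * (l + N) ≤ 2 * N := by
    calc d ^ 2 * (l + N) = d * (d * (l + N)) := by ring
      _ ≤ 1 * (d * (l + N)) := by gcongr
      _ ≤ _ := by linarith
  have e3 : c * N ^ 2 / 12 * (d ^ 2 * (l + N)) ≤ c * N ^ 2 / 12 * (2 * N) := by gcongr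
  have e4 : 0 ≤ c * N ^ 3 := by positivity
  nlinarith

/-! ### Linear energy bounds. -/

namespace PositiveEnergyRep

variable {H : Type*} [NormedAddCommGroup H] [InnerProductSpace ℂ H] {R : PositiveEnergyRep H}

/-- Lowering and raising are treated together: `max h (h - n)` is the larger of the energies of `v`
and `Lₙ v`. Raising follows from lowering by `norm_act_neg_sq`. -/
theorem norm_act_sq_le (n : ℤ) {h : ℝ} {v : R.Dfin}
    (hv : v ∈ eigenspace (R.act 0) (h : ℂ)) :
    ‖R.act n v‖ ^ 2
      ≤ ((max h (h - n)) ^ 2 + |R.c| * (max h (h - n)) * |(n : ℝ)| ^ 2 / 12) * ‖v‖ ^ 2 := by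
  rw [sq_abs]
  rcases lt_or_ge h 0 with h0 | h0
  · rw [eq_zero_of_energy_neg hv h0]
    simp
  rcases lt_trichotomy n 0 with hn | rfl | hn
  · have hn' : (n : ℝ) ≤ -1 := by exact_mod_cast Int.le_sub_one_of_lt hn
    have h1 := norm_act_sq_le_of_pos (neg_pos.mpr hn) hv
    have h2 := norm_act_neg_sq hv (-n)
    rw [neg_neg] at h2
    rw [h2, max_eq_right (by linarith)]
    push_cast at h1 ⊢
    have h3 : R.c / 12 * ((-(n : ℝ)) ^ 3 - -n) ≤ |R.c| / 12 * (-(n : ℝ)) ^ 3 := by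
      have : 0 ≤ (-(n : ℝ)) ^ 3 - -n := by nlinarith
      calc _ ≤ |R.c| / 12 * ((-(n : ℝ)) ^ 3 - -n) := by gcongr; exact le_abs_self _
        _ ≤ _ := by gcongr; linarith
    calc _ ≤ ((h ^ 2 + |R.c| * h * (-n) ^ 2 / 12)
          + (2 * -n * h + |R.c| / 12 * (-(n : ℝ)) ^ 3)) * ‖v‖ ^ 2 := by
          rw [add_mul _ (2 * -n * h + |R.c| / 12 * (-(n : ℝ)) ^ 3)]
          exact add_le_add h1 (mul_le_mul_of_nonneg_right (by linarith) (sq_nonneg _))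
      _ ≤ _ := by
          refine mul_le_mul_of_nonneg_right ?_ (sq_nonneg _)
          nlinarith [sq_nonneg (n : ℝ)]
  · rw [mem_eigenspace_iff.mp hv, norm_smul]
    simp [mul_pow]
  · have hn' : (1 : ℝ) ≤ n := by exact_mod_cast hn
    rw [max_eq_left (by linarith)]
    exact norm_act_sq_le_of_pos hn hv

theorem norm_act_le_of_mem_eigenspace (n : ℤ) {h : ℝ} {v : R.Dfin} (h0 : 0 ≤ h)
    (hv : v ∈ eigenspace (R.act 0) (h : ℂ)) :
    ‖R.act n v‖ ≤ (4 + |R.c|) * weight n * ((1 + h) * ‖v‖) := by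
  have hw := one_le_weight n
  have hw3 := abs_cube_le_weight_sq n
  have hc := abs_nonneg R.c
  refine le_of_sq_le_sq ?_ (by positivity)
  refine (norm_act_sq_le n hv).trans ?_
  have hg : max h (h - n) ≤ h + |(n : ℝ)| :=
    max_le (by linarith [abs_nonneg (n : ℝ)]) (by linarith [neg_abs_le (n : ℝ)])
  have hg0 : 0 ≤ max h (h - n) := h0.trans (le_max_left _ _)
  have key : (max h (h - n)) ^ 2 + |R.c| * (max h (h - n)) * |(n : ℝ)| ^ 2 / 12
      ≤ (4 + |R.c|) * weight n ^ 2 * (1 + h) ^ 2 := by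
    rcases eq_or_ne n 0 with rfl | hn
    · have h1 : 1 ≤ (4 + |R.c|) * weight 0 ^ 2 := by nlinarith
      simp only [Int.cast_zero, sub_zero, max_self, abs_zero]
      calc _ = h ^ 2 := by ring
        _ ≤ 1 * (1 + h) ^ 2 := by rw [one_mul]; gcongr; linarith
        _ ≤ _ := by gcongr
    have hN : (1 : ℝ) ≤ |(n : ℝ)| := by
      exact_mod_cast Int.one_le_abs hn
    have hg2 : max h (h - n) ≤ |(n : ℝ)| * (1 + h) := by nlinarith
    generalize |(n : ℝ)| = N at *
    generalize max h (h - n) = g at *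
    have e1 : g ^ 2 ≤ N ^ 3 * (1 + h) ^ 2 := by
      calc g ^ 2 ≤ (N * (1 + h)) ^ 2 := by gcongr
        _ = N ^ 2 * (1 + h) ^ 2 := by ring
        _ ≤ _ := by gcongr; linarith
    -- The central term is what forces the power `N³`, hence the exponent `3/2` after taking roots.
    have e2 : g * N ^ 2 ≤ N ^ 3 * (1 + h) ^ 2 := by
      calc g * N ^ 2 ≤ (N * (1 + h)) * N ^ 2 := by gcongr
        _ = N ^ 3 * (1 + h) ^ 1 := by ring
        _ ≤ _ := by
          gcongr
          · linarith
          · norm_num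
    have e3 : N ^ 3 * (1 + h) ^ 2 ≤ weight n ^ 2 * (1 + h) ^ 2 := by gcongr
    have e4 : |R.c| * (g * N ^ 2) ≤ |R.c| * (weight n ^ 2 * (1 + h) ^ 2) :=
      mul_le_mul_of_nonneg_left (e2.trans e3) hc
    have : 0 ≤ weight n ^ 2 * (1 + h) ^ 2 := by positivity
    have : 0 ≤ |R.c| * (weight n ^ 2 * (1 + h) ^ 2) := by positivity
    nlinarith
  calc _ ≤ (4 + |R.c|) * weight n ^ 2 * (1 + h) ^ 2 * ‖v‖ ^ 2 := by gcongr
    _ ≤ (4 + |R.c|) ^ 2 * weight n ^ 2 * (1 + h) ^ 2 * ‖v‖ ^ 2 := by gcongr; nlinarith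
    _ = _ := by ring

/-- The linear energy bounds for the generators. -/
theorem norm_act_le (n : ℤ) (v : R.Dfin) :
    ‖R.act n v‖ ≤ (4 + |R.c|) * weight n * ‖v + R.act 0 v‖ := by
  have hw := one_le_weight n
  have hk : 0 ≤ (4 + |R.c|) * weight n := by positivity
  have := R.isSymmetric_act_zero.norm_le_of_eigenspace R.iSup_eigenspace_act_zero
    (X := R.act n) (Y := (((4 + |R.c|) * weight n : ℝ) : ℂ) • (LinearMap.id + R.act 0)) (-n)
    (fun μ v hv => act_mem_eigenspace hv n)
    (fun μ v hv => Submodule.smul_mem _ _ (add_mem hv (by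
      simpa using act_mem_eigenspace hv 0))) ?_ v
  · rwa [LinearMap.smul_apply, LinearMap.add_apply, LinearMap.id_apply, norm_smul,
      Complex.norm_real, Real.norm_of_nonneg hk] at this
  · intro μ v hv
    rcases eq_or_ne v 0 with rfl | hv0
    · simp
    obtain ⟨h, h0, rfl⟩ := exists_energy_of_mem_eigenspace hv hv0
    refine (norm_act_le_of_mem_eigenspace n h0 hv).trans_eq ?_
    rw [LinearMap.smul_apply, LinearMap.add_apply, LinearMap.id_apply, mem_eigenspace_iff.mp hv,
      norm_smul, Complex.norm_real, Real.norm_of_nonneg hk]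
    congr 1
    have : v + (h : ℂ) • v = ((1 + h : ℝ) : ℂ) • v := by
      push_cast
      rw [add_smul, one_smul]
    rw [this, norm_smul, Complex.norm_real,
      Real.norm_of_nonneg (by positivity)]

end PositiveEnergyRep
end Virasoro

/-! ### The regularization and its commutators with the generators. -/

namespace Virasoro.PositiveEnergyRep

variable {H : Type*} [NormedAddCommGroup H] [InnerProductSpace ℂ H] (R : PositiveEnergyRep H)

/-- The regularization `φₖ(L₀)` by the cutoff function, on finite-energy vectors. -/
noncomputable def reg (k : ℕ) : R.Dfin →ₗ[ℂ] R.Dfin :=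
  (LinearMap.IsSymmetric.exists_eigenspace_multiplier R.iSup_eigenspace_act_zero
    fun μ => ((cutoff k μ.re : ℝ) : ℂ)).choose

variable {R}

theorem reg_apply_of_mem_eigenspace (k : ℕ) {μ : ℂ} {v : R.Dfin}
    (hv : v ∈ eigenspace (R.act 0) μ) : R.reg k v = ((cutoff k μ.re : ℝ) : ℂ) • v :=
  (LinearMap.IsSymmetric.exists_eigenspace_multiplier R.iSup_eigenspace_act_zero
    fun μ => ((cutoff k μ.re : ℝ) : ℂ)).choose_spec μ v hv

theorem energy_induction {p : R.Dfin → Prop}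
    (h : ∀ μ, ∀ v ∈ eigenspace (R.act 0) μ, p v) (hadd : ∀ v w, p v → p w → p (v + w))
    (v : R.Dfin) : p v :=
  Submodule.iSup_induction (motive := p) (eigenspace (R.act 0))
    (R.iSup_eigenspace_act_zero ▸ Submodule.mem_top : v ∈ ⨆ μ, eigenspace (R.act 0) μ)
    h (h 0 0 (zero_mem _)) hadd

theorem inner_reg_left (k : ℕ) (v w : R.Dfin) : ⟪R.reg k v, w⟫_ℂ = ⟪v, R.reg k w⟫_ℂ := by
  induction v using energy_induction with
  | hadd v v' h h' => rw [map_add, inner_add_left, inner_add_left, h, h']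
  | h μ v hv =>
    induction w using energy_induction with
    | hadd w w' h h' => rw [map_add, inner_add_right, inner_add_right, h, h']
    | h ν w hw =>
      rw [reg_apply_of_mem_eigenspace k hv, reg_apply_of_mem_eigenspace k hw, inner_smul_left,
        inner_smul_right, Complex.conj_ofReal]
      rcases eq_or_ne μ ν with rfl | hne
      · rfl
      · have : ⟪v, w⟫_ℂ = 0 :=
          R.isSymmetric_act_zero.orthogonalFamily_eigenspaces hne ⟨v, hv⟩ ⟨w, hw⟩
        rw [this, mul_zero, mul_zero]

theorem norm_reg_le (k : ℕ) (v : R.Dfin) : ‖R.reg k v‖ ≤ ‖v‖ := by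
  refine R.isSymmetric_act_zero.norm_le_of_eigenspace R.iSup_eigenspace_act_zero
    (X := R.reg k) (Y := LinearMap.id) 0 (fun μ v hv => ?_) (fun μ v hv => hv)
    (fun μ v hv => ?_) v
  · rw [reg_apply_of_mem_eigenspace k hv, add_zero]
    exact Submodule.smul_mem _ _ hv
  · rcases eq_or_ne v 0 with rfl | hv0
    · simp
    obtain ⟨h, h0, rfl⟩ := exists_energy_of_mem_eigenspace hv hv0
    rw [reg_apply_of_mem_eigenspace k hv, norm_smul, Complex.norm_real, Complex.ofReal_re,
      Real.norm_of_nonneg (cutoff_nonneg _ _)]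
    exact mul_le_of_le_one_left (norm_nonneg _) (cutoff_le_one k h0)

/-- With the energy bounds this makes `A⁺ φₖ(L₀)` bounded, with norm `O(k)`. -/
theorem norm_reg_add_act_zero_reg_le (k : ℕ) (v : R.Dfin) :
    ‖R.reg k v + R.act 0 (R.reg k v)‖ ≤ (k + 2) * ‖v‖ := by
  have hk : (0 : ℝ) ≤ k + 2 := by positivity
  have := R.isSymmetric_act_zero.norm_le_of_eigenspace R.iSup_eigenspace_act_zero
    (X := R.reg k + R.act 0 ∘ₗ R.reg k) (Y := ((k + 2 : ℝ) : ℂ) • LinearMap.id) 0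
    (fun μ v hv => ?_) (fun μ v hv => Submodule.smul_mem _ _ hv) (fun μ v hv => ?_) v
  · rwa [LinearMap.smul_apply, LinearMap.id_apply, norm_smul, Complex.norm_real,
      Real.norm_of_nonneg hk] at this
  · rw [LinearMap.add_apply, LinearMap.comp_apply, reg_apply_of_mem_eigenspace k hv, map_smul,
      mem_eigenspace_iff.mp hv, add_zero]
    exact add_mem (Submodule.smul_mem _ _ hv) (Submodule.smul_mem _ _ (Submodule.smul_mem _ _ hv))
  · rcases eq_or_ne v 0 with rfl | hv0
    · simp
    obtain ⟨h, h0, rfl⟩ := exists_energy_of_mem_eigenspace hv hv0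
    have e : R.reg k v + R.act 0 (R.reg k v) = (((1 + h) * cutoff k h : ℝ) : ℂ) • v := by
      rw [reg_apply_of_mem_eigenspace k hv, map_smul, mem_eigenspace_iff.mp hv, Complex.ofReal_re,
        smul_smul, ← add_smul]
      push_cast
      congr 1
      ring
    rw [LinearMap.add_apply, LinearMap.comp_apply, e, LinearMap.smul_apply, LinearMap.id_apply,
      norm_smul, norm_smul, Complex.norm_real, Complex.norm_real, Real.norm_of_nonneg hk,
      Real.norm_of_nonneg (mul_nonneg (by positivity) (cutoff_nonneg _ _))]
    exact mul_le_mul_of_nonneg_right (one_add_mul_cutoff_le k h0) (norm_nonneg _)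

theorem tendsto_reg (v : R.Dfin) : Tendsto (fun k => R.reg k v) atTop (𝓝 v) := by
  induction v using energy_induction with
  | hadd v v' h h' => simpa only [map_add] using h.add h'
  | h μ v hv =>
    simp only [reg_apply_of_mem_eigenspace _ hv]
    have h1 : Tendsto (fun k => ((cutoff k μ.re : ℝ) : ℂ)) atTop (𝓝 ((1 : ℝ) : ℂ)) :=
      (Complex.continuous_ofReal.tendsto 1).comp (tendsto_cutoff μ.re)
    simpa using h1.smul_const v

variable (R) in
/-- The commutator of the regularization with a generator. -/
noncomputable def regComm (k : ℕ) (n : ℤ) : R.Dfin →ₗ[ℂ] R.Dfin :=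
  R.reg k ∘ₗ R.act n - R.act n ∘ₗ R.reg k

theorem regComm_apply (k : ℕ) (n : ℤ) (v : R.Dfin) :
    R.regComm k n v = R.reg k (R.act n v) - R.act n (R.reg k v) := rfl

theorem regComm_apply_of_mem_eigenspace (k : ℕ) (n : ℤ) {μ : ℂ} {v : R.Dfin}
    (hv : v ∈ eigenspace (R.act 0) μ) :
    R.regComm k n v = ((cutoff k (μ.re - n) - cutoff k μ.re : ℝ) : ℂ) • R.act n v := by
  rw [regComm_apply, reg_apply_of_mem_eigenspace k hv,
    reg_apply_of_mem_eigenspace k (act_mem_eigenspace hv n), map_smul, ← sub_smul]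
  simp [sub_eq_add_neg]

/-- On an eigenvector the commutator is `Lₙ` times an increment of the cutoff, whose smallness
compensates the growth of `Lₙ` with the energy. The bound thus involves `‖v‖` alone and not `k`. -/
theorem norm_regComm_le (k : ℕ) (n : ℤ) (v : R.Dfin) :
    ‖R.regComm k n v‖ ≤ (4 + |R.c|) * weight n * ‖v‖ := by
  have hw := one_le_weight n
  have hc := abs_nonneg R.c
  have hk : 0 ≤ (4 + |R.c|) * weight n := by positivity
  have := R.isSymmetric_act_zero.norm_le_of_eigenspace R.iSup_eigenspace_act_zero
    (X := R.regComm k n) (Y := (((4 + |R.c|) * weight n : ℝ) : ℂ) • LinearMap.id) (-n)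
    (fun μ v hv => ?_) (fun μ v hv => Submodule.smul_mem _ _ hv) (fun μ v hv => ?_) v
  · rwa [LinearMap.smul_apply, LinearMap.id_apply, norm_smul, Complex.norm_real,
      Real.norm_of_nonneg hk] at this
  · rw [regComm_apply_of_mem_eigenspace k n hv]
    exact Submodule.smul_mem _ _ (act_mem_eigenspace hv n)
  · rw [LinearMap.smul_apply, LinearMap.id_apply, norm_smul, Complex.norm_real,
      Real.norm_of_nonneg hk]
    rcases eq_or_ne v 0 with rfl | hv0
    · simp
    obtain ⟨h, h0, rfl⟩ := exists_energy_of_mem_eigenspace hv hv0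
    rw [regComm_apply_of_mem_eigenspace k n hv, Complex.ofReal_re]
    rcases lt_or_ge (h - n) 0 with h1 | h1
    · rw [eq_zero_of_energy_neg (act_mem_eigenspace_ofReal hv n) h1, smul_zero, norm_zero]
      positivity
    refine le_of_sq_le_sq ?_ (by positivity)
    rw [norm_smul, Complex.norm_real, mul_pow, Real.norm_eq_abs, sq_abs]
    have key : (cutoff k (h - n) - cutoff k h) ^ 2 *
        ((max h (h - n)) ^ 2 + |R.c| * (max h (h - n)) * |(n : ℝ)| ^ 2 / 12)
          ≤ 4 * |(n : ℝ)| ^ 2 + |R.c| * |(n : ℝ)| ^ 3 := by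
      rcases le_total 0 (n : ℝ) with hn | hn
      · have := cutoff_diff_sq_mul_le k hc h1 (abs_nonneg (n : ℝ))
        rw [abs_of_nonneg hn, sub_add_cancel] at this
        rwa [max_eq_left (by linarith), abs_of_nonneg hn]
      · have := cutoff_diff_sq_mul_le k hc h0 (abs_nonneg (n : ℝ))
        rw [abs_of_nonpos hn, ← sub_eq_add_neg] at this
        rwa [max_eq_right (by linarith), abs_of_nonpos hn, ← neg_sub, neg_sq]
    have hN : |(n : ℝ)| ^ 2 ≤ |(n : ℝ)| ^ 3 := by
      rcases eq_or_ne n 0 with rfl | hn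
      · simp
      · exact pow_le_pow_right₀ (by exact_mod_cast Int.one_le_abs hn) (by norm_num)
    have hw3 := abs_cube_le_weight_sq n
    calc _ ≤ (cutoff k (h - n) - cutoff k h) ^ 2 *
        (((max h (h - n)) ^ 2 + |R.c| * (max h (h - n)) * |(n : ℝ)| ^ 2 / 12) * ‖v‖ ^ 2) := by
          gcongr
          exact norm_act_sq_le n hv
      _ ≤ (4 * |(n : ℝ)| ^ 2 + |R.c| * |(n : ℝ)| ^ 3) * ‖v‖ ^ 2 := by
          rw [← mul_assoc]
          gcongr
      _ ≤ ((4 + |R.c|) * weight n ^ 2) * ‖v‖ ^ 2 := by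
          gcongr
          rw [add_mul]
          exact add_le_add (mul_le_mul_of_nonneg_left (hN.trans hw3) (by norm_num))
            (mul_le_mul_of_nonneg_left hw3 hc)
      _ ≤ ((4 + |R.c|) ^ 2 * weight n ^ 2) * ‖v‖ ^ 2 := by
          gcongr
          nlinarith
      _ = _ := by ring

theorem tendsto_regComm (n : ℤ) (v : R.Dfin) :
    Tendsto (fun k => R.regComm k n v) atTop (𝓝 0) := by
  induction v using energy_induction with
  | hadd v v' h h' => simpa only [map_add, add_zero] using h.add h'
  | h μ v hv =>
    simp only [regComm_apply_of_mem_eigenspace _ _ hv]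
    have h1 : Tendsto (fun k => ((cutoff k (μ.re - n) - cutoff k μ.re : ℝ) : ℂ)) atTop
        (𝓝 ((1 - 1 : ℝ) : ℂ)) :=
      (Complex.continuous_ofReal.tendsto _).comp
        ((tendsto_cutoff (μ.re - n)).sub (tendsto_cutoff μ.re))
    simpa using h1.smul_const (R.act n v)

end Virasoro.PositiveEnergyRep

/-! ### The summed series and weak approximation in the graph of `A`. -/

theorem norm_le_of_norm_inner_le {H : Type*} [NormedAddCommGroup H] [InnerProductSpace ℂ H]
    {D : Set H} (hD : Dense D) {z : H} {C : ℝ} (hC : 0 ≤ C)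
    (h : ∀ w ∈ D, ‖⟪z, w⟫_ℂ‖ ≤ C * ‖w‖) : ‖z‖ ≤ C := by
  have hcl : IsClosed {w : H | ‖⟪z, w⟫_ℂ‖ ≤ C * ‖w‖} :=
    isClosed_le (by fun_prop) (by fun_prop)
  have hz : ‖⟪z, z⟫_ℂ‖ ≤ C * ‖z‖ :=
    hcl.closure_subset_iff.mpr h (hD.closure_eq ▸ Set.mem_univ z)
  rcases (norm_nonneg z).eq_or_lt with h0 | h0
  · rwa [← h0]
  · rw [inner_self_eq_norm_sq_to_K, norm_pow, sq] at hz
    simpa [h0] using hz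

namespace Virasoro

theorem summable_plusCoeff {a : ℤ → ℂ} (ha : Summable fun n => ‖a n‖ * weight n) :
    Summable fun n => ‖plusCoeff a n‖ * weight n := by
  refine ((Equiv.neg ℤ).summable_iff.mpr ha).congr fun n => ?_
  simp [plusCoeff, weight]

namespace PositiveEnergyRep

variable {H : Type*} [NormedAddCommGroup H] [InnerProductSpace ℂ H] {R : PositiveEnergyRep H}

variable (R) in
/-- The sum of the series `∑ₙ aₙ Lₙ v`. -/
noncomputable def modeSum (a : ℤ → ℂ) (v : R.Dfin) : H := ∑' n, a n • (R.act n v : H)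

theorem norm_smul_act_le (a : ℤ → ℂ) (v : R.Dfin) (n : ℤ) :
    ‖a n • (R.act n v : H)‖ ≤ ‖a n‖ * weight n * ((4 + |R.c|) * ‖v + R.act 0 v‖) := by
  rw [norm_smul]
  calc _ ≤ ‖a n‖ * ((4 + |R.c|) * weight n * ‖v + R.act 0 v‖) :=
        mul_le_mul_of_nonneg_left (norm_act_le n v) (norm_nonneg _)
    _ = _ := by ring

theorem norm_smul_regComm_le (b : ℤ → ℂ) (k : ℕ) (w : R.Dfin) (n : ℤ) :
    ‖b n • (R.regComm k n w : H)‖ ≤ ‖b n‖ * weight n * ((4 + |R.c|) * ‖w‖) := by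
  rw [norm_smul]
  calc _ ≤ ‖b n‖ * ((4 + |R.c|) * weight n * ‖w‖) :=
        mul_le_mul_of_nonneg_left (norm_regComm_le k n w) (norm_nonneg _)
    _ = _ := by ring

variable {a b : ℤ → ℂ}

theorem norm_modeSum_le (ha : Summable fun n => ‖a n‖ * weight n) (v : R.Dfin) :
    ‖R.modeSum a v‖ ≤ (∑' n, ‖a n‖ * weight n) * ((4 + |R.c|) * ‖v + R.act 0 v‖) :=
  tsum_of_norm_bounded (ha.hasSum.mul_right _) (norm_smul_act_le a v)

variable [CompleteSpace H]

theorem summable_smul_act (ha : Summable fun n => ‖a n‖ * weight n) (v : R.Dfin) :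
    Summable fun n => a n • (R.act n v : H) :=
  .of_norm_bounded (ha.mul_right _) (norm_smul_act_le a v)

theorem summable_smul_regComm (hb : Summable fun n => ‖b n‖ * weight n) (k : ℕ) (w : R.Dfin) :
    Summable fun n => b n • (R.regComm k n w : H) :=
  .of_norm_bounded (hb.mul_right _) (norm_smul_regComm_le b k w)

theorem inner_modeSum_left (ha : Summable fun n => ‖a n‖ * weight n) (v w : R.Dfin) :
    ⟪R.modeSum a v, (w : H)⟫_ℂ = ⟪(v : H), R.modeSum (plusCoeff a) w⟫_ℂ := by
  have h1 := ((summable_smul_act ha v).hasSum.mapL (innerSL ℂ (w : H))).star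
  have h2 := (summable_smul_act (summable_plusCoeff ha) w).hasSum.mapL (innerSL ℂ (v : H))
  rw [← (Equiv.neg ℤ).hasSum_iff] at h2
  simp only [innerSL_apply_apply] at h1 h2
  have e : (star ⟪(w : H), R.modeSum a v⟫_ℂ) = ⟪R.modeSum a v, (w : H)⟫_ℂ := inner_conj_symm _ _
  rw [← e]
  refine h1.unique (h2.congr_fun fun n => ?_)
  have h3 : ⟪(v : H), (R.act (-n) w : H)⟫_ℂ = ⟪(R.act n v : H), (w : H)⟫_ℂ :=
    (R.inner_act_left n v w).symm
  rw [Function.comp_apply, Equiv.neg_apply, inner_smul_right, inner_smul_right, h3, star_mul',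
    plusCoeff, neg_neg]
  congr 1
  exact inner_conj_symm _ _

/-- The effect of moving the regularization through the series. -/
theorem inner_modeSum_reg (ha : Summable fun n => ‖a n‖ * weight n) (k : ℕ) (v w : R.Dfin) :
    ⟪R.modeSum a (R.reg k v), (w : H)⟫_ℂ = ⟪(v : H), R.modeSum (plusCoeff a) (R.reg k w)⟫_ℂ
      + ⟪(v : H), ∑' n, plusCoeff a n • (R.regComm k n w : H)⟫_ℂ := by
  have hb := summable_plusCoeff ha
  have h1 := (summable_smul_act hb w).hasSum.mapL (innerSL ℂ (R.reg k v : H))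
  have h2 := (summable_smul_act hb (R.reg k w)).hasSum.mapL (innerSL ℂ (v : H))
  have h3 := (summable_smul_regComm hb k w).hasSum.mapL (innerSL ℂ (v : H))
  rw [inner_modeSum_left ha]
  refine h1.unique ((h2.add h3).congr_fun fun n => ?_)
  have h4 : ⟪(R.reg k v : H), (R.act n w : H)⟫_ℂ = ⟪(v : H), (R.reg k (R.act n w) : H)⟫_ℂ :=
    inner_reg_left k v (R.act n w)
  simp only [innerSL_apply_apply, inner_smul_right]
  rw [h4, ← mul_add, ← inner_add_right, ← Submodule.coe_add, regComm_apply, add_sub_cancel]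

/-- Dominated convergence: each term tends to zero, and the commutator bound is a summable majorant
independent of `k`. -/
theorem tendsto_tsum_regComm (hb : Summable fun n => ‖b n‖ * weight n) (w : R.Dfin) :
    Tendsto (fun k => ∑' n, b n • (R.regComm k n w : H)) atTop (𝓝 0) := by
  have := tendsto_tsum_of_dominated_convergence (𝓕 := atTop)
    (f := fun k n => b n • (R.regComm k n w : H)) (g := fun _ => 0) (hb.mul_right _)
    (fun n => ?_) (Eventually.of_forall fun k => norm_smul_regComm_le b k w)
  · simpa using this
  · simpa using ((R.Dfin.subtypeL.continuous.tendsto 0).comp (tendsto_regComm n w)).const_smul (b n)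

/-- The hypothesis says `y = (A⁺)* x`; the conclusion places `(x, y)` in the weak sequential closure
of the graph of `A`. -/
theorem exists_tendsto_inner (ha : Summable fun n => ‖a n‖ * weight n) {x y : H}
    (hxy : ∀ w : R.Dfin, ⟪y, (w : H)⟫_ℂ = ⟪x, R.modeSum (plusCoeff a) w⟫_ℂ) :
    ∃ u : ℕ → R.Dfin, (∀ q : H, Tendsto (fun k => ⟪(u k : H), q⟫_ℂ) atTop (𝓝 ⟪x, q⟫_ℂ)) ∧
      ∀ q : H, Tendsto (fun k => ⟪R.modeSum a (u k), q⟫_ℂ) atTop (𝓝 ⟪y, q⟫_ℂ) := by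
  have hb := summable_plusCoeff ha
  have hD : Dense (R.Dfin : Set H) := R.dense_fin
  set S := ∑' n, ‖plusCoeff a n‖ * weight n with hS
  have hS0 : 0 ≤ S := tsum_nonneg fun n =>
    mul_nonneg (norm_nonneg _) (zero_le_one.trans (one_le_weight n))
  set K := S * (4 + |R.c|) with hK
  have hK0 : 0 ≤ K := by positivity
  -- Bounds `A⁺ φₖ(L₀)`; the extra `1` gives `M k ≥ 1`, so that `hx` below also yields `vₖ → x`.
  let M : ℕ → ℝ := fun k => K * (k + 2) + 1
  have hM : ∀ k, 1 ≤ M k := fun k => le_add_of_nonneg_left (by positivity)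
  have hM' : ∀ k (w : R.Dfin), ‖R.modeSum (plusCoeff a) (R.reg k w)‖ ≤ M k * ‖w‖ := by
    intro k w
    calc _ ≤ S * ((4 + |R.c|) * ((k + 2) * ‖w‖)) := by
          refine (norm_modeSum_le hb _).trans ?_
          gcongr
          exact norm_reg_add_act_zero_reg_le k w
      _ = (K * (k + 2)) * ‖w‖ := by rw [hK]; ring
      _ ≤ _ := by gcongr; exact le_add_of_nonneg_right zero_le_one
  have hC : ∀ k (w : R.Dfin), ‖∑' n, plusCoeff a n • (R.regComm k n w : H)‖ ≤ K * ‖w‖ := by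
    intro k w
    rw [hK, mul_assoc]
    exact tsum_of_norm_bounded (hb.hasSum.mul_right _) (norm_smul_regComm_le _ k w)
  have hx : ∀ k : ℕ, ∃ v : R.Dfin, ‖(v : H) - x‖ * M k ≤ 1 / (k + 1) := by
    intro k
    have hMk : 0 < M k := zero_lt_one.trans_le (hM k)
    obtain ⟨v, hv, hvD⟩ := Metric.dense_iff.mp hD x (1 / (k + 1) / M k) (by positivity)
    refine ⟨⟨v, hvD⟩, ?_⟩
    rw [← le_div_iff₀ hMk, ← dist_eq_norm]
    exact (Metric.mem_ball.mp hv).le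
  choose v hv using hx
  have hv1 : ∀ k, ‖(v k : H) - x‖ ≤ 1 / (k + 1) := fun k =>
    (le_mul_of_one_le_right (norm_nonneg _) (hM k)).trans (hv k)
  have hk1 : ∀ k : ℕ, 1 / ((k : ℝ) + 1) ≤ 1 := fun k => by
    rw [div_le_one (by positivity)]
    linarith [k.cast_nonneg (α := ℝ)]
  have hv2 : ∀ k, ‖v k‖ ≤ ‖x‖ + 1 := fun k => by
    have := norm_add_le ((v k : H) - x) x
    rw [sub_add_cancel] at this
    have h2 := hv1 k
    have h3 := hk1 k
    rw [Submodule.coe_norm]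
    linarith
  have hvx : Tendsto (fun k => (v k : H)) atTop (𝓝 x) := by
    rw [tendsto_iff_norm_sub_tendsto_zero]
    exact squeeze_zero (fun _ => norm_nonneg _) hv1 tendsto_one_div_add_atTop_nhds_zero_nat
  have hT : ∀ w : R.Dfin, Tendsto (fun k => (R.reg k w : H)) atTop (𝓝 (w : H)) := fun w =>
    (R.Dfin.subtypeL.continuous.tendsto w).comp (tendsto_reg w)
  -- Replacing `vₖ` by `x` costs an error killed by the choice of `vₖ`; the main term becomes `⟪y,
  -- φₖ(L₀) w⟫`, and the commutator term is bounded uniformly and tends to zero.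
  have hdec : ∀ k (w : R.Dfin), ⟪R.modeSum a (R.reg k (v k)), (w : H)⟫_ℂ
      = ⟪(v k : H) - x, R.modeSum (plusCoeff a) (R.reg k w)⟫_ℂ + ⟪y, (R.reg k w : H)⟫_ℂ
        + ⟪(v k : H), ∑' n, plusCoeff a n • (R.regComm k n w : H)⟫_ℂ := by
    intro k w
    rw [inner_modeSum_reg ha, hxy, ← inner_add_left, sub_add_cancel]
  have hsmall : ∀ k (w : R.Dfin),
      ‖⟪(v k : H) - x, R.modeSum (plusCoeff a) (R.reg k w)⟫_ℂ‖ ≤ 1 / (k + 1) * ‖w‖ := by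
    intro k w
    calc _ ≤ ‖(v k : H) - x‖ * (M k * ‖w‖) :=
          (norm_inner_le_norm _ _).trans (mul_le_mul_of_nonneg_left (hM' k w) (norm_nonneg _))
      _ = ‖(v k : H) - x‖ * M k * ‖w‖ := by ring
      _ ≤ _ := by gcongr; exact hv k
  refine ⟨fun k => R.reg k (v k), tendsto_inner_of_dense hD (C := ‖x‖ + 1) ?_ ?_,
    tendsto_inner_of_dense hD (C := 1 + ‖y‖ + (‖x‖ + 1) * K) ?_ ?_⟩
  · exact fun k => (norm_reg_le k (v k)).trans (hv2 k)
  · intro w hw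
    have h : ∀ k, ⟪(R.reg k (v k) : H), w⟫_ℂ = ⟪(v k : H), (R.reg k ⟨w, hw⟩ : H)⟫_ℂ :=
      fun k => inner_reg_left k (v k) ⟨w, hw⟩
    simp only [h]
    exact hvx.inner (hT ⟨w, hw⟩)
  · intro k
    refine norm_le_of_norm_inner_le hD (by positivity) fun w hw => ?_
    rw [hdec k ⟨w, hw⟩]
    have h1 := hsmall k ⟨w, hw⟩
    have h2 : ‖⟪y, (R.reg k ⟨w, hw⟩ : H)⟫_ℂ‖ ≤ ‖y‖ * ‖w‖ :=
      (norm_inner_le_norm _ _).trans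
        (mul_le_mul_of_nonneg_left (norm_reg_le k ⟨w, hw⟩) (norm_nonneg _))
    have h3 : ‖⟪(v k : H), ∑' n, plusCoeff a n • (R.regComm k n ⟨w, hw⟩ : H)⟫_ℂ‖
        ≤ (‖x‖ + 1) * (K * ‖w‖) :=
      (norm_inner_le_norm _ _).trans
        (mul_le_mul (hv2 k) (hC k ⟨w, hw⟩) (norm_nonneg _) (by positivity))
    have h4 : 1 / ((k : ℝ) + 1) * ‖w‖ ≤ 1 * ‖w‖ := by gcongr; exact hk1 k
    calc _ ≤ _ := norm_add₃_le
      _ ≤ 1 * ‖w‖ + ‖y‖ * ‖w‖ + (‖x‖ + 1) * (K * ‖w‖) := by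
          gcongr
          exact h1.trans h4
      _ = _ := by ring
  · intro w hw
    have h1 : Tendsto
        (fun k => ⟪(v k : H) - x, R.modeSum (plusCoeff a) (R.reg k ⟨w, hw⟩)⟫_ℂ) atTop (𝓝 0) :=
      squeeze_zero_norm (fun k => hsmall k ⟨w, hw⟩)
        (by simpa using (tendsto_one_div_add_atTop_nhds_zero_nat (𝕜 := ℝ)).mul_const ‖w‖)
    have h2 : Tendsto (fun k => ⟪y, (R.reg k ⟨w, hw⟩ : H)⟫_ℂ) atTop (𝓝 ⟪y, w⟫_ℂ) :=
      tendsto_const_nhds.inner (hT ⟨w, hw⟩)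
    have h3 := hvx.inner (𝕜 := ℂ) (tendsto_tsum_regComm hb ⟨w, hw⟩)
    have := (h1.add h2).add h3
    rw [inner_zero_right, add_zero, zero_add] at this
    exact this.congr fun k => (hdec k ⟨w, hw⟩).symm

end PositiveEnergyRep
end Virasoro

/-! ### Closures of formally adjoint operators. -/

namespace LinearPMap

variable {H : Type*} [NormedAddCommGroup H] [InnerProductSpace ℂ H] [CompleteSpace H]
  {A B : H →ₗ.[ℂ] H}

/-- If the adjoints of two formally adjoint operators are formally adjoint to each other, then
each operator has the adjoint of the other one as its closure. -/
theorem closure_eq_adjoint_of_isFormalAdjoint (hA : Dense (A.domain : Set H))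
    (hB : Dense (B.domain : Set H)) (h : B.IsFormalAdjoint A)
    (hadj : B.adjoint.IsFormalAdjoint A.adjoint) : A.IsClosable ∧ A.closure = B.adjoint := by
  have hle : A ≤ B.adjoint := h.le_adjoint hB
  have hcl : A.IsClosable := (adjoint_isClosed hB).isClosable.leIsClosable hle
  refine ⟨hcl, eq_of_eq_graph (le_antisymm ?_ ?_)⟩
  · rw [← hcl.graph_closure_eq_closure_graph]
    exact Submodule.topologicalClosure_minimal _ (le_graph_of_le hle) (adjoint_isClosed hB)
  · rw [← hcl.graph_closure_eq_closure_graph]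
    -- It remains to see that the graph of `B*` lies in the double adjoint of that of `A`, which is
    -- exactly what `hadj` says.
    refine le_trans ?_ (Submodule.adjoint_adjoint_le_topologicalClosure A.graph)
    intro z hz
    rw [← adjoint_graph_eq_graph_adjoint hA, Submodule.mem_adjoint_iff]
    intro p q hpq
    obtain ⟨x, hx1, hx2⟩ := (mem_graph_iff _).mp hz
    obtain ⟨y, hy1, hy2⟩ := (mem_graph_iff _).mp hpq
    rw [← hx1, ← hx2]
    simp only at hy1 hy2
    rw [← hy1, ← hy2, sub_eq_zero]
    exact hadj.symm y x

/-- A densely defined symmetric operator with symmetric adjoint is essentially self-adjoint. -/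
theorem isSelfAdjoint_closure_of_isFormalAdjoint (hA : Dense (A.domain : Set H))
    (h : A.IsFormalAdjoint A) (hadj : A.adjoint.IsFormalAdjoint A.adjoint) :
    IsSelfAdjoint A.closure := by
  have hcl := (closure_eq_adjoint_of_isFormalAdjoint hA hA h hadj).2
  have hle : A ≤ A.adjoint := h.le_adjoint hA
  have hd : Dense (A.adjoint.domain : Set H) := hA.mono hle.1
  rw [hcl, isSelfAdjoint_def]
  refine le_antisymm (IsFormalAdjoint.le_adjoint hA fun x y => ?_) (hadj.le_adjoint hd)
  have := (adjoint_isFormalAdjoint hd).symm ⟨x, hle.1 x.2⟩ y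
  rwa [← hle.2 (x := x) (y := ⟨x, hle.1 x.2⟩) rfl] at this

end LinearPMap

/-! ### Application to the series and to Fourier coefficients. -/

namespace Virasoro

theorem plusCoeff_fourierHat (f : Circle → ℝ) : plusCoeff (fourierHat f) = fourierHat f := by
  ext n
  rw [plusCoeff, fourierHat, fourierHat, map_mul]
  congr 1
  · simp [map_ofNat]
  · rw [intervalIntegral.integral_of_le (by positivity),
      intervalIntegral.integral_of_le (by positivity), ← integral_conj]
    refine MeasureTheory.integral_congr_ae (Eventually.of_forall fun α => ?_)
    simp [← Complex.exp_conj]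

namespace PositiveEnergyRep

variable {H : Type*} [NormedAddCommGroup H] [InnerProductSpace ℂ H] [CompleteSpace H]
  {R : PositiveEnergyRep H} {a : ℤ → ℂ}

theorem series_domain (ha : Summable fun n => ‖a n‖ * weight n) :
    (R.series a).domain = R.Dfin := by
  ext v
  exact ⟨fun h => h.fst, fun h => ⟨h, summable_smul_act ha ⟨v, h⟩⟩⟩

theorem dense_series_domain (ha : Summable fun n => ‖a n‖ * weight n) :
    Dense ((R.series a).domain : Set H) := by
  rw [series_domain ha]
  exact R.dense_fin

theorem series_isFormalAdjoint (ha : Summable fun n => ‖a n‖ * weight n) :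
    (R.series (plusCoeff a)).IsFormalAdjoint (R.series a) :=
  LinearPMap.IsFormalAdjoint.symm fun v w =>
    inner_modeSum_left ha ⟨(v : H), v.2.fst⟩ ⟨(w : H), w.2.fst⟩

theorem series_adjoint_isFormalAdjoint (ha : Summable fun n => ‖a n‖ * weight n) :
    (R.series (plusCoeff a)).adjoint.IsFormalAdjoint (R.series a).adjoint := by
  have hb := summable_plusCoeff ha
  intro x q
  obtain ⟨u, hu, hu'⟩ := exists_tendsto_inner (R := R) ha (x := x)
    (y := (R.series (plusCoeff a)).adjoint x) fun w =>
      LinearPMap.adjoint_isFormalAdjoint (dense_series_domain (R := R) hb) x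
        ⟨(w : H), (series_domain hb).ge w.2⟩
  -- Both sides are limits of `⟪A uₖ, q⟫ = ⟪uₖ, A* q⟫`; weak convergence suffices since `q` and `A*
  -- q` are fixed.
  refine tendsto_nhds_unique (hu' q) ((hu _).congr fun k => ?_)
  exact ((LinearPMap.adjoint_isFormalAdjoint (dense_series_domain (R := R) ha)).symm
    ⟨(u k : H), (series_domain ha).ge (u k).2⟩ q).symm

theorem series_isClosable_and_closure_eq (ha : Summable fun n => ‖a n‖ * weight n) :
    (R.series a).IsClosable ∧ (R.series a).closure = (R.series (plusCoeff a)).adjoint :=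
  LinearPMap.closure_eq_adjoint_of_isFormalAdjoint (dense_series_domain ha)
    (dense_series_domain (summable_plusCoeff ha)) (series_isFormalAdjoint ha)
    (series_adjoint_isFormalAdjoint ha)

theorem series_essentiallySelfAdjoint (ha : Summable fun n => ‖a n‖ * weight n)
    (hreal : plusCoeff a = a) : EssentiallySelfAdjoint (R.series a) := by
  have h1 := series_isFormalAdjoint (R := R) ha
  have h2 := series_adjoint_isFormalAdjoint (R := R) ha
  rw [hreal] at h1 h2
  exact ⟨dense_series_domain ha, (series_isClosable_and_closure_eq ha).1,
    LinearPMap.isSelfAdjoint_closure_of_isFormalAdjoint (dense_series_domain ha) h1 h2⟩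

end PositiveEnergyRep

theorem summable_mul_weight {a : ℤ → ℂ}
    (ha : Summable fun n : ℤ => ‖a n‖ * |(n : ℝ)| ^ (3 / 2 : ℝ)) :
    Summable fun n => ‖a n‖ * weight n := by
  have h : Summable fun n => ‖a n‖ := by
    -- The factor `|n|^{3/2}` vanishes at `n = 0`, so the comparison holds only off that index.
    refine ha.of_norm_bounded_eventually ?_
    filter_upwards [(Set.finite_singleton (0 : ℤ)).compl_mem_cofinite] with n hn
    rw [norm_norm]
    refine le_mul_of_one_le_right (norm_nonneg _) (Real.one_le_rpow ?_ (by norm_num))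
    exact_mod_cast Int.one_le_abs hn
  simpa only [weight, mul_add, mul_one] using h.add ha

end Virasoro

theorem theorem4p4 {H : Type*} [NormedAddCommGroup H] [InnerProductSpace ℂ H] [CompleteSpace H]
    (R : Virasoro.PositiveEnergyRep H) :
    (∀ a : ℤ → ℂ, Summable (fun n : ℤ => ‖a n‖ * |(n : ℝ)| ^ (3 / 2 : ℝ)) →
      (R.series a).domain = R.Dfin ∧
      (R.series (Virasoro.plusCoeff a)).domain = R.Dfin ∧
      (R.series a).IsClosable ∧
      (R.series a).closure = (R.series (Virasoro.plusCoeff a)).adjoint ∧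
      ((∀ n : ℤ, a n = (starRingEnd ℂ) (a (-n))) →
        Virasoro.EssentiallySelfAdjoint (R.series a))) ∧
    (∀ f : Circle → ℝ, Continuous f →
      Summable (fun n : ℤ => ‖Virasoro.fourierHat f n‖ * (1 + |(n : ℝ)| ^ (3 / 2 : ℝ))) →
      (R.series (Virasoro.fourierHat f)).domain = R.Dfin ∧
      Virasoro.EssentiallySelfAdjoint (R.series (Virasoro.fourierHat f)) ∧
      IsSelfAdjoint (R.stressEnergy f)) := by
  refine ⟨fun a ha => ?_, fun f _ hf => ?_⟩
  · have hw := Virasoro.summable_mul_weight ha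
    have hcl := Virasoro.PositiveEnergyRep.series_isClosable_and_closure_eq (R := R) hw
    exact ⟨Virasoro.PositiveEnergyRep.series_domain hw,
      Virasoro.PositiveEnergyRep.series_domain (Virasoro.summable_plusCoeff hw), hcl.1, hcl.2,
      fun h => Virasoro.PositiveEnergyRep.series_essentiallySelfAdjoint hw
        (funext fun n => (h n).symm)⟩
  · have hsa := Virasoro.PositiveEnergyRep.series_essentiallySelfAdjoint (R := R) hf
      (Virasoro.plusCoeff_fourierHat f)
    exact ⟨Virasoro.PositiveEnergyRep.series_domain hf, hsa, hsa.2.2⟩
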